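/- Let $q,\alpha$ be complex numbers with $|q|<1$ and $1+\alpha q^{2n}\neq 0$ for all $n\ge 1$. Write $(a;q)_n=\prod_{i=0}^{n-1}(1-aq^i)$ and $(a;q)_\infty=\prod_{i\ge 0}(1-aq^i)$, and let $$\phi(\alpha;q)=\sum_{n=0}^\infty \frac{q^{n^2}}{(-\alpha q;q^2)_n}$$ be Andrews' two-variable generalization of Ramanujan's third order mock theta function, so that $\phi(-\alpha q;-q)=\sum_{n\ge 0}\frac{(-1)^nq^{n^2}}{(-\alpha q^2;q^2)_n}$. Let $P_{do}$ be the set of (nonempty) integer partitions into distinct parts whose smallest part is odd, and for a partition $\nu$ let $l(\nu)$ be its number of parts and $|\nu|$ the sum of its parts. Then the infinite product and all the series below converge (unconditionally), and $$(-\alpha q;q)_\infty\,\phi(-\alpha q;-q)=1+\sum_{\nu\in P_{do}}\alpha^{l(\nu)}q^{|\nu|}+\sum_{k=1}^\infty(-1)^kq^{k^2}.$$ -/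

import Mathlib

/-- The finite `q`-shifted factorial `(a;q)_n = (1 - a)(1 - a q) ⋯ (1 - a q^(n-1))`. -/
noncomputable def qPoch (a q : ℂ) (n : ℕ) : ℂ :=
  ∏ i ∈ Finset.range n, (1 - a * q ^ i)

/-- The infinite `q`-shifted factorial `(a;q)_∞ = ∏_{n ≥ 0} (1 - a q^n)`, for `|q| < 1`. -/
noncomputable def qPochInf (a q : ℂ) : ℂ :=
  ∏' n : ℕ, (1 - a * q ^ n)

/-- Andrews' two-variable function `φ(α;q) = ∑_{n ≥ 0} q^(n^2) / (-α q; q^2)_n`. -/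
noncomputable def andrewsPhi (α q : ℂ) : ℂ :=
  ∑' n : ℕ, q ^ (n ^ 2) / qPoch (-α * q) (q ^ 2) n

/-- The set of all integer partitions (of all sizes) into distinct parts whose smallest part
exists and is odd; an element is a pair of the size `n` and a partition of `n`. -/
def partitionsDistinctSmallestOdd : Set (Σ n : ℕ, n.Partition) :=
  {ν | ν.2.parts.Nodup ∧ ∃ m ∈ ν.2.parts, Odd m ∧ ∀ j ∈ ν.2.parts, m ≤ j}

/-!
Write `a = -α`. Splitting `(aq;q)_∞` by the parity of the exponent and cancelling the denominators
of `φ`, the left-hand side becomes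
`L(a) = (aq;q²)_∞ ∑_{n ≥ 0} (-1)^n q^{n²} (aq^{2n+2};q²)_∞`,
which is free of denominators (`completedPhi`, `qPochInf_mul_andrewsPhi`). It satisfies
`L(a) - L(aq²) = -aq (aq²;q)_∞`: taking out `(aq³;q²)_∞`, the difference of the two series
telescopes (`completedPhi_sub`). Iterating, and using that `L(aq^{2N})` tends to
`∑_{n ≥ 0} (-1)^n q^{n²}` as `N → ∞`, gives
`L(a) = ∑_{n ≥ 0} (-1)^n q^{n²} + ∑_{m ≥ 0} (-aq^{2m+1}) (aq^{2m+2};q)_∞` (`completedPhi_eq`).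

The `m`-th term of the last series generates the partitions into distinct parts with smallest part
`2m+1`: such a partition consists of that part and an arbitrary finite set of parts that are at
least `2m+2`, and `∏ (1 + f i)` expands into the sum of `∏_{i ∈ s} f i` over finite sets `s`
(`hasSum_partitionWeight`).
-/

open Filter Topology

/-! ### Infinite `q`-shifted factorials -/

lemma summable_norm_neg_mul_pow (a : ℂ) {q : ℂ} (hq : ‖q‖ < 1) :
    Summable fun n : ℕ => ‖-(a * q ^ n)‖ := by
  simp only [norm_neg, norm_mul, norm_pow]
  exact (summable_geometric_of_lt_one (norm_nonneg q) hq).mul_left _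

lemma multipliable_one_sub_mul_pow (a : ℂ) {q : ℂ} (hq : ‖q‖ < 1) :
    Multipliable fun n : ℕ => 1 - a * q ^ n := by
  simpa only [sub_eq_add_neg] using
    multipliable_one_add_of_summable (summable_norm_neg_mul_pow a hq)

lemma norm_sq_lt_one {q : ℂ} (hq : ‖q‖ < 1) : ‖q ^ 2‖ < 1 := by
  rw [norm_pow]
  exact pow_lt_one₀ (norm_nonneg q) hq two_ne_zero

lemma norm_qPochInf_sub_one_le (a : ℂ) {q : ℂ} (hq : ‖q‖ < 1) :
    ‖qPochInf a q - 1‖ ≤ Real.exp (‖a‖ * (1 - ‖q‖)⁻¹) - 1 := by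
  have hlim := ((multipliable_one_sub_mul_pow a hq).hasProd.sub_const 1).norm
  refine le_of_tendsto hlim (Eventually.of_forall fun t => ?_)
  have hsum : ∑ i ∈ t, ‖-(a * q ^ i)‖ ≤ ‖a‖ * (1 - ‖q‖)⁻¹ := by
    rw [← tsum_geometric_of_lt_one (norm_nonneg q) hq, ← tsum_mul_left]
    refine le_trans ((summable_norm_neg_mul_pow a hq).sum_le_tsum t fun i _ => norm_nonneg _)
      (le_of_eq ?_)
    simp
  calc ‖∏ i ∈ t, (1 - a * q ^ i) - 1‖
      ≤ Real.exp (∑ i ∈ t, ‖-(a * q ^ i)‖) - 1 := by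
        simpa only [sub_eq_add_neg] using
          t.norm_prod_one_add_sub_one_le fun i => -(a * q ^ i)
    _ ≤ _ := by gcongr

lemma norm_qPochInf_le {a q : ℂ} (hq : ‖q‖ < 1) {A : ℝ} (ha : ‖a‖ ≤ A) :
    ‖qPochInf a q‖ ≤ Real.exp (A * (1 - ‖q‖)⁻¹) := by
  have h := norm_qPochInf_sub_one_le a hq
  have h1 : ‖qPochInf a q‖ ≤ ‖qPochInf a q - 1‖ + 1 := by
    simpa using norm_add_le (qPochInf a q - 1) 1
  have h2 : 0 ≤ (1 - ‖q‖)⁻¹ := inv_nonneg.2 (by linarith)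
  calc ‖qPochInf a q‖ ≤ Real.exp (‖a‖ * (1 - ‖q‖)⁻¹) := by linarith
    _ ≤ _ := by gcongr

lemma tendsto_qPochInf_of_tendsto_zero {q : ℂ} (hq : ‖q‖ < 1) {ι : Type*} {l : Filter ι}
    {u : ι → ℂ} (hu : Tendsto u l (𝓝 0)) :
    Tendsto (fun i => qPochInf (u i) q) l (𝓝 1) := by
  rw [tendsto_iff_norm_sub_tendsto_zero]
  refine squeeze_zero (fun _ => norm_nonneg _) (fun i => norm_qPochInf_sub_one_le (u i) hq) ?_
  have h : Continuous fun x : ℝ => Real.exp (x * (1 - ‖q‖)⁻¹) - 1 := by fun_prop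
  simpa [Function.comp_def] using (h.tendsto 0).comp (tendsto_zero_iff_norm_tendsto_zero.1 hu)

lemma qPochInf_eq_qPoch_mul (a : ℂ) {q : ℂ} (hq : ‖q‖ < 1) (n : ℕ) :
    qPochInf a q = qPoch a q n * qPochInf (a * q ^ n) q := by
  have h : Multipliable fun i : ℕ => 1 - a * q ^ (i + n) := by
    simpa only [pow_add, mul_assoc, mul_comm (q ^ n)] using
      multipliable_one_sub_mul_pow (a * q ^ n) hq
  have := h.prod_mul_tprod_nat_mul' (f := fun i : ℕ => 1 - a * q ^ i)
  simp only [qPochInf, qPoch]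
  rw [← this]
  congr 2
  ext i
  ring

lemma qPochInf_eq_one_sub_mul (a : ℂ) {q : ℂ} (hq : ‖q‖ < 1) :
    qPochInf a q = (1 - a) * qPochInf (a * q) q := by
  simpa [qPoch] using qPochInf_eq_qPoch_mul a hq 1

lemma qPochInf_eq_mul_base_sq (a : ℂ) {q : ℂ} (hq : ‖q‖ < 1) :
    qPochInf a q = qPochInf a (q ^ 2) * qPochInf (a * q) (q ^ 2) := by
  have he := multipliable_one_sub_mul_pow a (norm_sq_lt_one hq)
  have ho := multipliable_one_sub_mul_pow (a * q) (norm_sq_lt_one hq)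
  have h1 : ∀ n : ℕ, 1 - a * (q ^ 2) ^ n = 1 - a * q ^ (2 * n) := fun n => by rw [pow_mul]
  have h2 : ∀ n : ℕ, 1 - a * q * (q ^ 2) ^ n = 1 - a * q ^ (2 * n + 1) := fun n => by ring
  simp only [qPochInf, h1, h2] at he ho ⊢
  exact (tprod_even_mul_odd (f := fun n => 1 - a * q ^ n) he ho).symm

lemma norm_mul_pow_le (a : ℂ) {q : ℂ} (hq : ‖q‖ < 1) (n : ℕ) : ‖a * q ^ n‖ ≤ ‖a‖ := by
  rw [norm_mul, norm_pow]
  exact mul_le_of_le_one_right (norm_nonneg a) (pow_le_one₀ (norm_nonneg q) hq.le)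

lemma summable_norm_pow_sq {q : ℂ} (hq : ‖q‖ < 1) : Summable fun n : ℕ => ‖q‖ ^ (n ^ 2) :=
  (summable_geometric_of_lt_one (norm_nonneg q) hq).of_nonneg_of_le
    (fun n => by positivity)
    fun n => pow_le_pow_of_le_one (norm_nonneg q) hq.le (Nat.le_self_pow two_ne_zero n)

lemma norm_neg_one_pow_mul_pow_sq (q : ℂ) (n : ℕ) :
    ‖(-1 : ℂ) ^ n * q ^ (n ^ 2)‖ = ‖q‖ ^ (n ^ 2) := by
  simp

lemma summable_neg_one_pow_mul_pow_sq {q : ℂ} (hq : ‖q‖ < 1) :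
    Summable fun n : ℕ => (-1 : ℂ) ^ n * q ^ (n ^ 2) :=
  .of_norm (by simpa only [norm_neg_one_pow_mul_pow_sq] using summable_norm_pow_sq hq)

/-! ### The telescoping functional equation -/

/-- The `n`-th term `(-1)^n q^{n²} (aq^{2n+2};q²)_∞` of the series for `φ(aq;-q)` multiplied by
`(aq²;q²)_∞`. -/
noncomputable def thetaTerm (a q : ℂ) (n : ℕ) : ℂ :=
  (-1) ^ n * q ^ (n ^ 2) * qPochInf (a * q ^ (2 * n + 2)) (q ^ 2)

lemma norm_thetaTerm_le {a q : ℂ} (hq : ‖q‖ < 1) {A : ℝ} (ha : ‖a‖ ≤ A) (n : ℕ) :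
    ‖thetaTerm a q n‖ ≤ ‖q‖ ^ (n ^ 2) * Real.exp (A * (1 - ‖q ^ 2‖)⁻¹) := by
  rw [thetaTerm, norm_mul, norm_neg_one_pow_mul_pow_sq]
  gcongr
  exact norm_qPochInf_le (norm_sq_lt_one hq) ((norm_mul_pow_le a hq _).trans ha)

lemma summable_thetaTerm (a : ℂ) {q : ℂ} (hq : ‖q‖ < 1) : Summable (thetaTerm a q) :=
  .of_norm_bounded ((summable_norm_pow_sq hq).mul_right _) (norm_thetaTerm_le hq le_rfl)

/-- The product `(aq;q)_∞ φ(aq;-q)` with the denominators cancelled, so that it makes sense for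
every `a`. -/
noncomputable def completedPhi (a q : ℂ) : ℂ :=
  qPochInf (a * q) (q ^ 2) * ∑' n, thetaTerm a q n

/-- Once `(aq³;q²)_∞` is taken out, the terms of the two series differ by `-aq` times
`thetaTerm a q n - thetaTerm a q (n + 1)`. -/
lemma completedPhi_sub (a : ℂ) {q : ℂ} (hq : ‖q‖ < 1) :
    completedPhi a q - completedPhi (a * q ^ 2) q = -(a * q) * qPochInf (a * q ^ 2) q := by
  have hq2 := norm_sq_lt_one hq
  have hterm : ∀ n, (1 - a * q) * thetaTerm a q n - thetaTerm (a * q ^ 2) q n =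
      -(a * q) * (thetaTerm a q n - thetaTerm a q (n + 1)) := by
    intro n
    have e1 := qPochInf_eq_one_sub_mul (a * q ^ (2 * n + 2)) hq2
    rw [show a * q ^ (2 * n + 2) * q ^ 2 = a * q ^ (2 * (n + 1) + 2) by ring] at e1
    have e2 : a * q ^ 2 * q ^ (2 * n + 2) = a * q ^ (2 * (n + 1) + 2) := by ring
    simp only [thetaTerm, e1, e2]
    ring
  have htel := (summable_thetaTerm a hq).hasSum.sub
    ((summable_nat_add_iff 1).2 (summable_thetaTerm a hq)).hasSum
  have hzero := (summable_thetaTerm a hq).tsum_eq_zero_add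
  have h := ((summable_thetaTerm a hq).hasSum.mul_left (1 - a * q)).sub
    (summable_thetaTerm (a * q ^ 2) hq).hasSum
  have h' : HasSum (fun n => (1 - a * q) * thetaTerm a q n - thetaTerm (a * q ^ 2) q n)
      (-(a * q) * thetaTerm a q 0) := by
    have := htel.mul_left (-(a * q))
    rw [sub_eq_of_eq_add hzero] at this
    simpa only [hterm] using this
  have key := h.unique h'
  have e1 := qPochInf_eq_one_sub_mul (a * q) hq2
  have e2 : a * q ^ 2 * q = a * q * q ^ 2 := by ring
  have e3 := qPochInf_eq_mul_base_sq (a * q ^ 2) hq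
  have e4 : thetaTerm a q 0 = qPochInf (a * q ^ 2) (q ^ 2) := by simp [thetaTerm]
  rw [e4] at key
  rw [completedPhi, completedPhi, e3, e2, e1]
  linear_combination qPochInf (a * q * q ^ 2) (q ^ 2) * key

lemma tendsto_completedPhi {q : ℂ} (hq : ‖q‖ < 1) {u : ℕ → ℂ} {A : ℝ} (hA : ∀ n, ‖u n‖ ≤ A)
    (hu : Tendsto u atTop (𝓝 0)) :
    Tendsto (fun N => completedPhi (u N) q) atTop (𝓝 (∑' n : ℕ, (-1) ^ n * q ^ (n ^ 2))) := by
  have hq2 := norm_sq_lt_one hq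
  have hmul : ∀ b : ℂ, Tendsto (fun N => u N * b) atTop (𝓝 0) := fun b => by
    simpa using hu.mul_const b
  have hsum : Tendsto (fun N => ∑' n, thetaTerm (u N) q n) atTop
      (𝓝 (∑' n : ℕ, (-1) ^ n * q ^ (n ^ 2))) := by
    refine tendsto_tsum_of_dominated_convergence
      ((summable_norm_pow_sq hq).mul_right (Real.exp (A * (1 - ‖q ^ 2‖)⁻¹))) (fun n => ?_)
      (Eventually.of_forall fun N n => norm_thetaTerm_le hq (hA N) n)
    simpa [thetaTerm] using (tendsto_qPochInf_of_tendsto_zero hq2 (hmul _)).const_mul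
      ((-1 : ℂ) ^ n * q ^ (n ^ 2))
  simpa [completedPhi] using (tendsto_qPochInf_of_tendsto_zero hq2 (hmul q)).mul hsum

lemma completedPhi_eq (a : ℂ) {q : ℂ} (hq : ‖q‖ < 1)
    (hs : Summable fun m : ℕ => -(a * q ^ (2 * m + 1)) * qPochInf (a * q ^ (2 * m + 2)) q) :
    completedPhi a q = ∑' n : ℕ, (-1) ^ n * q ^ (n ^ 2)
      + ∑' m : ℕ, -(a * q ^ (2 * m + 1)) * qPochInf (a * q ^ (2 * m + 2)) q := by
  have hpart : ∀ N : ℕ, completedPhi a q = completedPhi (a * q ^ (2 * N)) q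
      + ∑ m ∈ Finset.range N, -(a * q ^ (2 * m + 1)) * qPochInf (a * q ^ (2 * m + 2)) q := by
    intro N
    induction N with
    | zero => simp
    | succ N ih =>
      have h := completedPhi_sub (a * q ^ (2 * N)) hq
      rw [show a * q ^ (2 * N) * q ^ 2 = a * q ^ (2 * N + 2) by ring,
        show a * q ^ (2 * N) * q = a * q ^ (2 * N + 1) by ring] at h
      rw [Finset.sum_range_succ, mul_add, mul_one]
      linear_combination ih + h
  have hu : Tendsto (fun N : ℕ => a * q ^ (2 * N)) atTop (𝓝 0) := by
    simpa [pow_mul] using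
      (tendsto_pow_atTop_nhds_zero_of_norm_lt_one (norm_sq_lt_one hq)).const_mul a
  have hlim := (tendsto_completedPhi hq (fun N => norm_mul_pow_le a hq _) hu).add
    hs.hasSum.tendsto_sum_nat
  exact tendsto_nhds_unique (tendsto_const_nhds.congr hpart) hlim

/-! ### Clearing the denominators of `φ` -/

lemma qPoch_ne_zero {α q : ℂ} (hα : ∀ n : ℕ, 1 ≤ n → 1 + α * q ^ (2 * n) ≠ 0) (n : ℕ) :
    qPoch (-(-α * q) * (-q)) ((-q) ^ 2) n ≠ 0 := by
  refine Finset.prod_ne_zero_iff.2 fun i _ => ?_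
  convert hα (i + 1) (by omega) using 1
  ring

lemma qPochInf_mul_phiTerm {α q : ℂ} (hq : ‖q‖ < 1)
    (hα : ∀ n : ℕ, 1 ≤ n → 1 + α * q ^ (2 * n) ≠ 0) (n : ℕ) :
    qPochInf (-α * q ^ 2) (q ^ 2) *
      ((-q) ^ (n ^ 2) / qPoch (-(-α * q) * (-q)) ((-q) ^ 2) n) = thetaTerm (-α) q n := by
  have h0 := qPoch_ne_zero hα n
  have h := qPochInf_eq_qPoch_mul (-α * q ^ 2) (norm_sq_lt_one hq) n
  have e : -(-α * q) * -q = -α * q ^ 2 := by ring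
  have hs : (-q) ^ (n ^ 2) = (-1) ^ n * q ^ (n ^ 2) := by
    rw [neg_pow]
    congr 1
    -- `n` and `n ^ 2` have the same parity.
    rcases Nat.even_or_odd n with hn | hn
    · rw [hn.neg_one_pow, (hn.pow_of_ne_zero two_ne_zero).neg_one_pow]
    · rw [hn.neg_one_pow, hn.pow.neg_one_pow]
  rw [e, neg_sq] at h0 ⊢
  rw [h, thetaTerm, hs, show -α * q ^ (2 * n + 2) = -α * q ^ 2 * (q ^ 2) ^ n by ring]
  generalize qPoch (-α * q ^ 2) (q ^ 2) n = p at h0 ⊢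
  field_simp

lemma qPochInf_ne_zero {α q : ℂ} (hq : ‖q‖ < 1)
    (hα : ∀ n : ℕ, 1 ≤ n → 1 + α * q ^ (2 * n) ≠ 0) : qPochInf (-α * q ^ 2) (q ^ 2) ≠ 0 := by
  have h := tprod_one_add_ne_zero_of_summable (f := fun n : ℕ => -(-α * q ^ 2 * (q ^ 2) ^ n))
    (fun n => ?_) (summable_norm_neg_mul_pow _ (norm_sq_lt_one hq))
  · simpa only [qPochInf, sub_eq_add_neg] using h
  · convert hα (n + 1) (by omega) using 1
    ring

lemma summable_phiTerm {α q : ℂ} (hq : ‖q‖ < 1)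
    (hα : ∀ n : ℕ, 1 ≤ n → 1 + α * q ^ (2 * n) ≠ 0) :
    Summable fun n : ℕ => (-q) ^ (n ^ 2) / qPoch (-(-α * q) * (-q)) ((-q) ^ 2) n := by
  rw [← summable_mul_left_iff (qPochInf_ne_zero hq hα)]
  simpa only [qPochInf_mul_phiTerm hq hα] using summable_thetaTerm (-α) hq

lemma qPochInf_mul_andrewsPhi {α q : ℂ} (hq : ‖q‖ < 1)
    (hα : ∀ n : ℕ, 1 ≤ n → 1 + α * q ^ (2 * n) ≠ 0) :
    qPochInf (-α * q) q * andrewsPhi (-α * q) (-q) = completedPhi (-α) q := by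
  have e : -α * q * q = -α * q ^ 2 := by ring
  rw [qPochInf_eq_mul_base_sq _ hq, e, andrewsPhi, completedPhi, mul_assoc, ← tsum_mul_left]
  simp only [qPochInf_mul_phiTerm hq hα]

/-! ### Partitions into distinct parts with odd smallest part -/

/-- The partition with smallest part `2m+1` whose remaining parts are `2m+2+i` for `i ∈ s`, where
`x = (m, s)`. -/
def partitionOfPair (x : ℕ × Finset ℕ) : partitionsDistinctSmallestOdd :=
  ⟨⟨_, { parts := (2 * x.1 + 1) ::ₘ x.2.val.map (2 * x.1 + 2 + ·)
         parts_pos := by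
          intro i hi
          simp only [Multiset.mem_cons, Multiset.mem_map] at hi
          omega
         parts_sum := rfl }⟩, by
    refine ⟨?_, 2 * x.1 + 1, Multiset.mem_cons_self _ _, odd_two_mul_add_one _, ?_⟩
    · simp only [Multiset.nodup_cons, Multiset.mem_map]
      exact ⟨by omega, x.2.nodup.map (add_right_injective _)⟩
    · intro j hj
      simp only [Multiset.mem_cons, Multiset.mem_map] at hj
      omega⟩

lemma sigma_partition_ext {ν μ : Σ n : ℕ, n.Partition} (h : ν.2.parts = μ.2.parts) : ν = μ := by
  obtain ⟨n, p, hp, rfl⟩ := ν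
  obtain ⟨m, p', hp', rfl⟩ := μ
  obtain rfl : p = p' := h
  rfl

lemma partitionOfPair_injective : Function.Injective partitionOfPair := by
  rintro ⟨m, s⟩ ⟨m', s'⟩ h
  have hp : (2 * m + 1) ::ₘ s.val.map (2 * m + 2 + ·)
      = (2 * m' + 1) ::ₘ s'.val.map (2 * m' + 2 + ·) :=
    congrArg (fun ν : partitionsDistinctSmallestOdd => ν.1.2.parts) h
  have hm : m = m' := by
    have h1 : 2 * m + 1 ∈ (2 * m' + 1) ::ₘ s'.val.map (2 * m' + 2 + ·) :=
      hp ▸ Multiset.mem_cons_self _ _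
    have h2 : 2 * m' + 1 ∈ (2 * m + 1) ::ₘ s.val.map (2 * m + 2 + ·) :=
      hp ▸ Multiset.mem_cons_self _ _
    simp only [Multiset.mem_cons, Multiset.mem_map] at h1 h2
    rcases h1 with h1 | ⟨i, -, h1⟩ <;> rcases h2 with h2 | ⟨j, -, h2⟩ <;> omega
  subst hm
  rw [Multiset.cons_inj_right] at hp
  rw [Finset.val_injective (Multiset.map_injective (add_right_injective _) hp)]

lemma partitionOfPair_surjective : Function.Surjective partitionOfPair := by
  rintro ⟨ν, hnd, m, hm, ⟨k, rfl⟩, hmin⟩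
  have hnd' := hnd.erase (2 * k + 1)
  have hge : ∀ j ∈ ν.2.parts.erase (2 * k + 1), 2 * k + 2 ≤ j := fun j hj => by
    have h1 := (hnd.mem_erase_iff.1 hj).1
    have h2 := hmin j (Multiset.mem_of_mem_erase hj)
    omega
  refine ⟨(k, ⟨(ν.2.parts.erase (2 * k + 1)).map (· - (2 * k + 2)), ?_⟩), ?_⟩
  · refine hnd'.map_on fun x hx y hy hxy => ?_
    have := hge x hx
    have := hge y hy
    omega
  · refine Subtype.ext (sigma_partition_ext ?_)
    simp only [partitionOfPair, Multiset.map_map, Function.comp_apply]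
    rw [Multiset.map_congr rfl (g := id) fun j hj => by have := hge j hj; simp; omega,
      Multiset.map_id, Multiset.cons_erase hm]

/-- The weight of a partition into distinct parts is `∏ αq^i` over the set of its parts, so the
family embeds into the expansion of `∏ (1 + αq^i)` over finite sets. -/
lemma summable_partitionWeight (α : ℂ) {q : ℂ} (hq : ‖q‖ < 1) :
    Summable fun ν : partitionsDistinctSmallestOdd =>
      α ^ (Multiset.card ν.1.2.parts) * q ^ ν.1.1 := by
  have hs : Summable fun s : Finset ℕ => ∏ i ∈ s, α * q ^ i :=
    summable_finsetProd_of_summable_norm (by simpa using summable_norm_neg_mul_pow α hq)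
  have hinj : Function.Injective fun ν : partitionsDistinctSmallestOdd =>
      (⟨ν.1.2.parts, ν.2.1⟩ : Finset ℕ) := fun ν μ h =>
    Subtype.ext (sigma_partition_ext (congrArg Finset.val h))
  refine (hs.comp_injective hinj).congr fun ν => ?_
  rw [Function.comp_apply, Finset.prod_mul_distrib, Finset.prod_const, Finset.prod_pow_eq_pow_sum]
  congr 2
  exact (congrArg Multiset.sum (Multiset.map_id' _)).trans ν.1.2.parts_sum

lemma partitionWeight_partitionOfPair (α q : ℂ) (x : ℕ × Finset ℕ) :
    α ^ (Multiset.card (partitionOfPair x).1.2.parts) * q ^ (partitionOfPair x).1.1 =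
      α * q ^ (2 * x.1 + 1) * ∏ i ∈ x.2, α * q ^ (2 * x.1 + 2) * q ^ i := by
  have hcard : Multiset.card (partitionOfPair x).1.2.parts = x.2.card + 1 := by
    simp [partitionOfPair]
  have hsize : (partitionOfPair x).1.1
      = 2 * x.1 + 1 + (x.2.card * (2 * x.1 + 2) + ∑ i ∈ x.2, i) := by
    have h : (partitionOfPair x).1.1 = 2 * x.1 + 1 + ∑ i ∈ x.2, (2 * x.1 + 2 + i) :=
      Multiset.sum_cons _ _
    rw [h, Finset.sum_add_distrib, Finset.sum_const, smul_eq_mul]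
  have hpow : ∏ i ∈ x.2, q ^ i = q ^ ∑ i ∈ x.2, i := Finset.prod_pow_eq_pow_sum _ _ _
  rw [hcard, hsize, Finset.prod_mul_distrib, Finset.prod_const, hpow]
  ring

/-- Summation according to the smallest part `2m+1`. -/
lemma hasSum_partitionWeight (α : ℂ) {q : ℂ} (hq : ‖q‖ < 1) :
    HasSum (fun m : ℕ => α * q ^ (2 * m + 1) * qPochInf (-α * q ^ (2 * m + 2)) q)
      (∑' ν : partitionsDistinctSmallestOdd, α ^ (Multiset.card ν.1.2.parts) * q ^ ν.1.1) := by
  let e := Equiv.ofBijective partitionOfPair ⟨partitionOfPair_injective, partitionOfPair_surjective⟩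
  have h := (e.hasSum_iff.2 (summable_partitionWeight α hq).hasSum)
  refine h.prod_fiberwise fun m => ?_
  have hs : Summable fun s : Finset ℕ => ∏ i ∈ s, α * q ^ (2 * m + 2) * q ^ i :=
    summable_finsetProd_of_summable_norm
      (by simpa using summable_norm_neg_mul_pow (α * q ^ (2 * m + 2)) hq)
  have hp : qPochInf (-α * q ^ (2 * m + 2)) q
      = ∑' s : Finset ℕ, ∏ i ∈ s, α * q ^ (2 * m + 2) * q ^ i := by
    rw [← tprod_one_add hs, qPochInf]
    congr 1
    ext i
    ring
  rw [hp]
  have hm := hs.hasSum.mul_left (α * q ^ (2 * m + 1))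
  rwa [← funext fun s => partitionWeight_partitionOfPair α q (m, s)] at hm

/-! ### The identity -/

theorem theorem5p3 (α q : ℂ) (hq : ‖q‖ < 1)
    (hα : ∀ n : ℕ, 1 ≤ n → 1 + α * q ^ (2 * n) ≠ 0) :
    Multipliable (fun n : ℕ => 1 - (-α * q) * q ^ n) ∧
    Summable (fun n : ℕ => (-q) ^ (n ^ 2) / qPoch (-(-α * q) * (-q)) ((-q) ^ 2) n) ∧
    Summable (fun ν : partitionsDistinctSmallestOdd =>
      α ^ (Multiset.card ν.1.2.parts) * q ^ ν.1.1) ∧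
    Summable (fun k : ℕ+ => (-1 : ℂ) ^ (k : ℕ) * q ^ ((k : ℕ) ^ 2)) ∧
    qPochInf (-α * q) q * andrewsPhi (-α * q) (-q) =
      1 + ∑' ν : partitionsDistinctSmallestOdd,
            α ^ (Multiset.card ν.1.2.parts) * q ^ ν.1.1
        + ∑' k : ℕ+, (-1 : ℂ) ^ (k : ℕ) * q ^ ((k : ℕ) ^ 2) := by
  have htheta := summable_neg_one_pow_mul_pow_sq hq
  refine ⟨multipliable_one_sub_mul_pow _ hq, summable_phiTerm hq hα,
    summable_partitionWeight α hq, htheta.comp_injective PNat.coe_injective, ?_⟩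
  have hpart := hasSum_partitionWeight α hq
  have hneg : ∀ m : ℕ, -(-α * q ^ (2 * m + 1)) = α * q ^ (2 * m + 1) := fun m => by ring
  have h := completedPhi_eq (-α) hq (by simpa only [hneg] using hpart.summable)
  simp only [hneg, hpart.tsum_eq] at h
  rw [qPochInf_mul_andrewsPhi hq hα, h, htheta.tsum_eq_zero_add,
    tsum_pnat_eq_tsum_succ (f := fun k : ℕ => (-1 : ℂ) ^ k * q ^ (k ^ 2))]
  simp only [pow_zero, ne_eq, OfNat.ofNat_ne_zero, not_false_eq_true, zero_pow, mul_one]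
  ring
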